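/- Let $m\ge 0$ and let $v:\mathbb{R}\to\mathbb{C}$ belong to $W^{2,\infty}_{\mathrm{loc}}(\mathbb{R})$, with weak derivatives $v^{(1)},v^{(2)}$. Let $H_V$ be the maximal one-dimensional Dirac operator with the purely electric potential $V=\mathrm{diag}(v,v)$ in the Hilbert space $\mathcal{H}=L^2(\mathbb{R})\oplus L^2(\mathbb{R})$, i.e. $$H_V\begin{pmatrix}f_1\\ f_2\end{pmatrix}=\begin{pmatrix}-i f_2'+(v+m)f_1\\ -i f_1'+(v-m)f_2\end{pmatrix},\qquad \mathcal{D}(H_V)=\{f\in\mathcal{H}: H_Vf\in\mathcal{H}\},$$ where $H_Vf$ is understood in the sense of distributions. Assume that $$\limsup_{x\to-\infty}\operatorname{Im}v(x)<0,\qquad \liminf_{x\to+\infty}\operatorname{Im}v(x)>0 .$$ Assume moreover that there exist 1. a continuous function $f:\mathbb{R}\to\mathbb{R}$ which is unbounded at infinity (that is, unbounded on $\{|x|\ge R\}$ for every $R>0$) and constants $x_0>0$, $C>0$ such that $|f(x)|\le C\int_0^x\operatorname{Im}v(t)\,\mathrm{d}t$ for all $|x|\ge x_0$; 2. constants $\nu_-,\nu_+\in\mathbb{R}$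 such that, for each $n\in\{1,2\}$ and each choice of sign, $$|v^{(n)}(x)|=\mathcal{O}\bigl(|f(x)|^{n\nu_\pm}|v(x)|\bigr)\qquad\text{as }x\to\pm\infty$$ (where a negative power of $0$ is read as $+\infty$). Then there exists a family $(\Psi_\lambda)_{\lambda\in\mathbb{R}}\subset\mathcal{D}(H_V)\setminus\{0\}$ such that $$\frac{\|(H_V-\lambda)\Psi_\lambda\|}{\|\Psi_\lambda\|}\longrightarrow 0\qquad\text{both as }\lambda\to+\infty\text{ and as }\lambda\to-\infty .$$ -/

import Mathlib

open MeasureTheory Filter Topology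

noncomputable section

namespace DiracPseudomodes

/-- Complex-valued test functions on the real line: smooth with compact support. -/
def IsTestFunction (φ : ℝ → ℂ) : Prop :=
  ContDiff ℝ ((⊤ : ℕ∞) : WithTop ℕ∞) φ ∧ HasCompactSupport φ

/-- `w` is the `n`-th weak (distributional) derivative of `u` on `ℝ`. -/
def IsWeakDeriv (n : ℕ) (u w : ℝ → ℂ) : Prop :=
  LocallyIntegrable u volume ∧ LocallyIntegrable w volume ∧
    ∀ φ : ℝ → ℂ, IsTestFunction φ →
      ∫ x, iteratedDeriv n φ x * u x = (-1) ^ n * ∫ x, φ x * w x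

open Classical in
/-- The `n`-th weak derivative of `u`, determined up to a null set when it exists
(and `0` when it does not exist). -/
def weakDeriv (n : ℕ) (u : ℝ → ℂ) : ℝ → ℂ :=
  if h : ∃ w, IsWeakDeriv n u w then h.choose else 0

/-- The space `L^∞_loc(ℝ)`. -/
def MemLinftyLoc (u : ℝ → ℂ) : Prop :=
  ∀ K : Set ℝ, IsCompact K → MemLp u ⊤ (volume.restrict K)

/-- The local Sobolev space `W^{k,∞}_loc(ℝ)`: all weak derivatives of order `0, …, k` exist
and lie in `L^∞_loc(ℝ)`. -/
def MemWinftyLoc (k : ℕ) (u : ℝ → ℂ) : Prop :=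
  ∀ n ≤ k, ∃ w, IsWeakDeriv n u w ∧ MemLinftyLoc w

/-- The Hilbert space `L²(ℝ) ⊕ L²(ℝ)`. -/
abbrev SpinorSpace : Type :=
  PiLp 2 (fun _ : Fin 2 => Lp ℂ 2 (volume : Measure ℝ))

/-- The products `V_{ij} f_j` are distributions, and `H_V f = g` in the sense of distributions:
`(-i∂ + V₁₂) f₂ + (V₁₁ + m) f₁ = g₁` and `(-i∂ + V₂₁) f₁ + (V₂₂ - m) f₂ = g₂`.
The integrability clause is automatic if the entries of `V` are locally square integrable. -/
def DiracEq (m : ℝ) (V : ℝ → Matrix (Fin 2) (Fin 2) ℂ) (f g : SpinorSpace) : Prop :=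
  (∀ i j, LocallyIntegrable (fun x => V x i j * f j x) volume) ∧
    ∀ φ : ℝ → ℂ, IsTestFunction φ →
      ∫ x, (Complex.I * deriv φ x * f 1 x
          + φ x * (V x 0 1 * f 1 x + (V x 0 0 * f 0 x + m * f 0 x))) = ∫ x, φ x * g 0 x ∧
      ∫ x, (Complex.I * deriv φ x * f 0 x
          + φ x * (V x 1 0 * f 0 x + (V x 1 1 * f 1 x - m * f 1 x))) = ∫ x, φ x * g 1 x

theorem IsTestFunction.integrable_mul {φ : ℝ → ℂ} (hφ : IsTestFunction φ) {u : ℝ → ℂ}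
    (hu : LocallyIntegrable u volume) : Integrable (fun x => φ x * u x) volume := by
  simpa using hu.integrable_smul_left_of_hasCompactSupport hφ.1.continuous hφ.2

theorem IsTestFunction.integrable_deriv_mul {φ : ℝ → ℂ} (hφ : IsTestFunction φ) {u : ℝ → ℂ}
    (hu : LocallyIntegrable u volume) :
    Integrable (fun x => Complex.I * deriv φ x * u x) volume := by
  have h := hu.integrable_smul_left_of_hasCompactSupport
    (hφ.1.continuous_deriv (by simp)) hφ.2.deriv
  simpa [mul_assoc] using h.const_mul Complex.I

theorem locallyIntegrable_coe (u : Lp ℂ 2 (volume : Measure ℝ)) :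
    LocallyIntegrable (u : ℝ → ℂ) volume :=
  (Lp.memLp u).locallyIntegrable (by norm_num)

theorem DiracEq.add {m : ℝ} {V : ℝ → Matrix (Fin 2) (Fin 2) ℂ} {f g f' g' : SpinorSpace}
    (h : DiracEq m V f g) (h' : DiracEq m V f' g') : DiracEq m V (f + f') (g + g') := by
  have e : ∀ (a b : SpinorSpace) (j : Fin 2),
      ((a + b) j : ℝ → ℂ) =ᵐ[volume] fun x => a j x + b j x :=
    fun a b j => Lp.coeFn_add (a j) (b j)
  refine ⟨fun i j => ?_, fun φ hφ => ?_⟩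
  · refine ((h.1 i j).add (h'.1 i j)).congr ?_
    filter_upwards [e f f' j] with x hx
    simp only [Pi.add_apply, hx]
    ring
  · have key : ∀ (i : Fin 2) (k : SpinorSpace),
        (∀ i j, LocallyIntegrable (fun x => V x i j * k j x) volume) → ∀ (c : ℂ) (a b : Fin 2),
        Integrable (fun x => Complex.I * deriv φ x * k a x
          + φ x * (V x i a * k a x + (V x i b * k b x + c * k b x))) volume := by
      intro i k hk c a b
      refine (hφ.integrable_deriv_mul (locallyIntegrable_coe (k a))).add
        (hφ.integrable_mul ((hk i a).add ((hk i b).add ?_)))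
      exact (locallyIntegrable_coe (k b)).smul c
    obtain ⟨h1, h2⟩ := h.2 φ hφ
    obtain ⟨h1', h2'⟩ := h'.2 φ hφ
    have kg : ∀ (a : SpinorSpace) (j : Fin 2), Integrable (fun x => φ x * a j x) volume :=
      fun a j => hφ.integrable_mul (locallyIntegrable_coe (a j))
    constructor
    · have hg : ∫ x, φ x * (g + g') 0 x = ∫ x, (φ x * g 0 x + φ x * g' 0 x) := by
        refine integral_congr_ae ?_
        filter_upwards [e g g' 0] with x hx
        rw [hx]; ring
      rw [hg, integral_add (kg g 0) (kg g' 0), ← h1, ← h1',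
        ← integral_add (key 0 f h.1 m 1 0) (key 0 f' h'.1 m 1 0)]
      refine integral_congr_ae ?_
      filter_upwards [e f f' 0, e f f' 1] with x hx hy
      rw [hx, hy]; ring
    · have hg : ∫ x, φ x * (g + g') 1 x = ∫ x, (φ x * g 1 x + φ x * g' 1 x) := by
        refine integral_congr_ae ?_
        filter_upwards [e g g' 1] with x hx
        rw [hx]; ring
      have k1 := key 1 f h.1 (-m) 0 1
      have k2 := key 1 f' h'.1 (-m) 0 1
      simp only [neg_mul, ← sub_eq_add_neg] at k1 k2
      rw [hg, integral_add (kg g 1) (kg g' 1), ← h2, ← h2', ← integral_add k1 k2]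
      refine integral_congr_ae ?_
      filter_upwards [e f f' 0, e f f' 1] with x hx hy
      rw [hx, hy]; ring

theorem DiracEq.smul {m : ℝ} {V : ℝ → Matrix (Fin 2) (Fin 2) ℂ} {f g : SpinorSpace}
    (c : ℂ) (h : DiracEq m V f g) : DiracEq m V (c • f) (c • g) := by
  have e : ∀ (a : SpinorSpace) (j : Fin 2),
      ((c • a) j : ℝ → ℂ) =ᵐ[volume] fun x => c * a j x :=
    fun a j => Lp.coeFn_smul c (a j)
  refine ⟨fun i j => ?_, fun φ hφ => ?_⟩
  · refine ((h.1 i j).smul c).congr ?_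
    filter_upwards [e f j] with x hx
    simp only [Pi.smul_apply, smul_eq_mul, hx]
    ring
  · obtain ⟨h1, h2⟩ := h.2 φ hφ
    constructor
    · have hg : ∫ x, φ x * (c • g) 0 x = ∫ x, c * (φ x * g 0 x) := by
        refine integral_congr_ae ?_
        filter_upwards [e g 0] with x hx
        rw [hx]; ring
      rw [hg, integral_const_mul, ← h1, ← integral_const_mul]
      refine integral_congr_ae ?_
      filter_upwards [e f 0, e f 1] with x hx hy
      rw [hx, hy]; ring
    · have hg : ∫ x, φ x * (c • g) 1 x = ∫ x, c * (φ x * g 1 x) := by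
        refine integral_congr_ae ?_
        filter_upwards [e g 1] with x hx
        rw [hx]; ring
      rw [hg, integral_const_mul, ← h2, ← integral_const_mul]
      refine integral_congr_ae ?_
      filter_upwards [e f 0, e f 1] with x hx hy
      rw [hx, hy]; ring

theorem DiracEq.zero (m : ℝ) (V : ℝ → Matrix (Fin 2) (Fin 2) ℂ) : DiracEq m V 0 0 := by
  have e : ∀ j : Fin 2, ((0 : SpinorSpace) j : ℝ → ℂ) =ᵐ[volume] fun _ => 0 :=
    fun j => Lp.coeFn_zero ℂ 2 volume
  have z : ∀ F : ℝ → ℂ, F =ᵐ[volume] (fun _ => 0) → ∫ x, F x = 0 := fun F hF => by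
    rw [integral_congr_ae hF]; simp
  refine ⟨fun i j => ?_, fun φ hφ => ?_⟩
  · refine (locallyIntegrable_const (0 : ℂ)).congr ?_
    filter_upwards [e j] with x hx
    rw [hx, mul_zero]
  · constructor
    · rw [z _ ?_, z _ ?_]
      · filter_upwards [e 0] with x hx
        rw [hx]; ring
      · filter_upwards [e 0, e 1] with x hx hy
        rw [hx, hy]; ring
    · rw [z _ ?_, z _ ?_]
      · filter_upwards [e 1] with x hx
        rw [hx]; ring
      · filter_upwards [e 0, e 1] with x hx hy
        rw [hx, hy]; ring

theorem eq_of_forall_test {a b : Lp ℂ 2 (volume : Measure ℝ)}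
    (h : ∀ φ : ℝ → ℂ, IsTestFunction φ → ∫ x, φ x * a x = ∫ x, φ x * b x) : a = b := by
  refine Lp.ext ?_
  refine ae_eq_of_integral_contDiff_smul_eq (locallyIntegrable_coe a) (locallyIntegrable_coe b) ?_
  intro φ hφ hc
  have ht : IsTestFunction (fun x => (φ x : ℂ)) :=
    ⟨Complex.ofRealCLM.contDiff.comp hφ, hc.comp_left (g := fun r : ℝ => (r : ℂ)) (by simp)⟩
  simpa using h _ ht

theorem DiracEq.unique {m : ℝ} {V : ℝ → Matrix (Fin 2) (Fin 2) ℂ} {f g g' : SpinorSpace}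
    (h : DiracEq m V f g) (h' : DiracEq m V f g') : g = g' := by
  ext1 j
  fin_cases j
  · exact eq_of_forall_test fun φ hφ => (h.2 φ hφ).1.symm.trans (h'.2 φ hφ).1
  · exact eq_of_forall_test fun φ hφ => (h.2 φ hφ).2.symm.trans (h'.2 φ hφ).2

/-- The maximal Dirac operator `H_V = -iσ₁ d/dx + m σ₃ + V` in `L²(ℝ) ⊕ L²(ℝ)`; its domain
consists of all `f` for which the distribution `H_V f` belongs to `L²(ℝ) ⊕ L²(ℝ)`. -/
def diracOperator (m : ℝ) (V : ℝ → Matrix (Fin 2) (Fin 2) ℂ) :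
    SpinorSpace →ₗ.[ℂ] SpinorSpace where
  domain :=
    { carrier := {f | ∃ g, DiracEq m V f g}
      add_mem' := fun ⟨g, h⟩ ⟨g', h'⟩ => ⟨g + g', h.add h'⟩
      zero_mem' := ⟨0, DiracEq.zero m V⟩
      smul_mem' := fun c _ ⟨g, h⟩ => ⟨c • g, h.smul c⟩ }
  toFun :=
    { toFun := fun f => f.2.choose
      map_add' := fun f f' =>
        (f + f').2.choose_spec.unique (f.2.choose_spec.add f'.2.choose_spec)
      map_smul' := fun c f => (c • f).2.choose_spec.unique (f.2.choose_spec.smul c) }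

/-- `H_V f = g` means exactly that the distribution `H_V f` is the element `g`. -/
theorem diracOperator_apply_eq_iff {m : ℝ} {V : ℝ → Matrix (Fin 2) (Fin 2) ℂ}
    (f : (diracOperator m V).domain) (g : SpinorSpace) :
    diracOperator m V f = g ↔ DiracEq m V f g := by
  have h : DiracEq m V f (diracOperator m V f) := f.2.choose_spec
  exact ⟨fun e => e ▸ h, fun h' => h.unique h'⟩

/-- The purely electric potential `diag(v, v)`. -/
def electric (v : ℝ → ℂ) (x : ℝ) : Matrix (Fin 2) (Fin 2) ℂ := !![v x, 0; 0, v x]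

end DiracPseudomodes

end

namespace DiracPseudomodes

/-! ### Locally bounded functions -/

section LocallyBounded

/-! For `m = 0` the equation `(H_V - l) Ψ = 0` is solved by `Ψ = (U, -U)/2` with `U = exp (i ∫₀ˣ (v
- l))`. Since `l` is real, `|U| = exp (-∫₀ˣ Im v)` does not depend on `l`, and the sign conditions
on `Im v` make it decay exponentially at both ends (`memLp_exp_neg_integral`).

For `m > 0` the mass term leaves the error `(m/2) (U, U)`, which is not small. Adding `(m/(4l)) (U,
U)` cancels it: `-iσ₁ d/dx + v - l` acts on `(U, U)` as multiplication by `2 (v - l)`, so only terms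
of size `m |v U| / |l|` and `m² |U| / |l|` survive.

Because `v U` need not be square integrable, `U` is multiplied by a cutoff `χ` at scale `X`, at the
price of a commutator `χ' U` of norm `O(1/X)`. As `|U|` is independent of `l`, one first fixes `X`
to make the commutator small, and then takes `|l|` large, `v` being bounded on the support of `χ`.
This is `exists_correctedMode` followed by `exists_approximate_eigenvector`; near-minimisers of the
quotient for each `l` then form a single family (`exists_selection_tendsto_zero`). -/

theorem MemLinftyLoc.exists_ae_norm_le {v : ℝ → ℂ} (hv : MemLinftyLoc v) {K : Set ℝ}
    (hK : IsCompact K) : ∃ M : ℝ, 0 ≤ M ∧ ∀ᵐ x, x ∈ K → ‖v x‖ ≤ M := by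
  have h := hv K hK
  refine ⟨(eLpNormEssSup v (volume.restrict K)).toReal, ENNReal.toReal_nonneg, ?_⟩
  rw [← ae_restrict_iff' hK.measurableSet]
  have hfin : eLpNormEssSup v (volume.restrict K) ≠ ⊤ := by
    rw [← eLpNorm_exponent_top]; exact h.2.ne
  filter_upwards [ae_le_eLpNormEssSup (f := v) (μ := volume.restrict K)] with x hx
  rw [← toReal_enorm]
  exact ENNReal.toReal_mono hfin hx

theorem MemLinftyLoc.locallyIntegrable {v : ℝ → ℂ} (hv : MemLinftyLoc v) :
    LocallyIntegrable v volume := by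
  refine locallyIntegrable_iff.2 fun K hK => ?_
  have : IsFiniteMeasure (volume.restrict K) := ⟨by simpa using hK.measure_lt_top⟩
  exact (hv K hK).integrable le_top

/-- The weak derivative of order `0` equals `v` almost everywhere, by testing against real bump
functions. -/
theorem MemWinftyLoc.memLinftyLoc {k : ℕ} {v : ℝ → ℂ} (hv : MemWinftyLoc k v) :
    MemLinftyLoc v := by
  obtain ⟨w, ⟨hv1, hw1, h⟩, hw⟩ := hv 0 (Nat.zero_le _)
  have hvw : v =ᵐ[volume] w := by
    refine ae_eq_of_integral_contDiff_smul_eq hv1 hw1 ?_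
    intro φ hφ hc
    have ht : IsTestFunction (fun x => (φ x : ℂ)) :=
      ⟨Complex.ofRealCLM.contDiff.comp hφ, hc.comp_left (g := fun r : ℝ => (r : ℂ)) (by simp)⟩
    simpa using h _ ht
  exact fun K hK => (hw K hK).ae_eq (ae_restrict_of_ae hvw.symm)

theorem _root_.MeasureTheory.LocallyIntegrable.intervalIntegrable_real {E : Type*}
    [NormedAddCommGroup E] {v : ℝ → E} (hv : LocallyIntegrable v volume) (a b : ℝ) :
    IntervalIntegrable v volume a b :=
  intervalIntegrable_iff.mpr <|
    (hv.integrableOn_isCompact isCompact_uIcc).mono_set Set.uIoc_subset_uIcc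

theorem MemLinftyLoc.const_mul_sub {v : ℝ → ℂ} (hv : MemLinftyLoc v) (c z : ℂ) :
    MemLinftyLoc fun x => c * (v x - z) := fun K hK => by
  have : IsFiniteMeasure (volume.restrict K) := ⟨by simpa using hK.measure_lt_top⟩
  exact ((hv K hK).sub (memLp_const z)).const_mul c

end LocallyBounded

/-! ### Absolutely continuous primitives and their exponentials -/

section AbsolutelyContinuous

/-- The fundamental theorem of calculus for an absolutely continuous function vanishing at the
end points. -/
theorem intervalIntegral_eq_zero_of_absolutelyContinuous {F F' : ℝ → ℂ} {a b : ℝ}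
    (hF : AbsolutelyContinuousOnInterval F a b)
    (hG : AbsolutelyContinuousOnInterval (fun x => ∫ t in a..x, F' t) a b)
    (hF' : LocallyIntegrable F' volume) (hd : ∀ᵐ x, HasDerivAt F (F' x) x)
    (ha : F a = 0) (hb : F b = 0) : ∫ t in a..b, F' t = 0 := by
  -- `F` minus the primitive of `F'` has zero derivative almost everywhere, hence is constant; its
  -- two end values are compared.
  obtain ⟨C, hC⟩ := (hF.sub hG).const_of_ae_hasDerivAt_zero (by
    filter_upwards [hd, LocallyIntegrable.ae_hasDerivAt_integral hF'] with x h1 h2 _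
    simpa using h1.sub (h2 a))
  have h1 := hC a (by simp)
  have h2 := hC b (by simp)
  simp only [Pi.sub_apply, ha, hb, intervalIntegral.integral_same] at h1 h2
  rw [← h1] at h2
  simpa using h2

theorem MemLinftyLoc.lipschitzOnWith_integral {w : ℝ → ℂ} (hw : MemLinftyLoc w) (c a b : ℝ) :
    ∃ K, LipschitzOnWith K (fun x => ∫ t in c..x, w t) (Set.uIcc a b) := by
  obtain ⟨M, hM0, hM⟩ := hw.exists_ae_norm_le (isCompact_uIcc (a := a) (b := b))
  refine ⟨⟨M, hM0⟩, LipschitzOnWith.of_dist_le_mul fun x hx y hy => ?_⟩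
  have hi := hw.locallyIntegrable.intervalIntegrable_real
  rw [dist_eq_norm, intervalIntegral.integral_interval_sub_left (hi _ _) (hi _ _)]
  refine intervalIntegral.norm_integral_le_of_norm_le_const_ae ?_
  filter_upwards [hM] with t ht hty
  exact ht (Set.uIcc_subset_uIcc hy hx (Set.uIoc_subset_uIcc hty))

theorem MemLinftyLoc.absolutelyContinuousOnInterval_integral {w : ℝ → ℂ} (hw : MemLinftyLoc w)
    (c a b : ℝ) : AbsolutelyContinuousOnInterval (fun x => ∫ t in c..x, w t) a b :=
  (hw.lipschitzOnWith_integral c a b).choose_spec.absolutelyContinuousOnInterval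

theorem MemLinftyLoc.absolutelyContinuousOnInterval_cexp {w : ℝ → ℂ} (hw : MemLinftyLoc w)
    (a b : ℝ) : AbsolutelyContinuousOnInterval (fun x => Complex.exp (∫ t in 0..x, w t)) a b := by
  obtain ⟨K, hK⟩ := hw.lipschitzOnWith_integral 0 a b
  obtain ⟨M, hM⟩ := isCompact_uIcc.exists_bound_of_continuousOn hK.continuousOn
  -- `exp` is Lipschitz only on bounded sets, so it is restricted to a ball containing the range of
  -- the primitive.
  obtain ⟨L, hL⟩ := (Complex.contDiff_exp (𝕜 := ℝ) (n := 1)).contDiffOn.exists_lipschitzOnWith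
    (by decide) (convex_closedBall (0 : ℂ) M) (isCompact_closedBall _ _)
  exact (hL.comp hK fun x hx => by simpa using hM x hx).absolutelyContinuousOnInterval

end AbsolutelyContinuous

/-! ### Exponential decay of the weight -/

section Decay

theorem integrableOn_exp_neg_of_linear_le {h : ℝ → ℝ} (hc : Continuous h) {c K R : ℝ} (hc0 : 0 < c)
    (hh : ∀ x ≥ R, c * x - K ≤ h x) :
    IntegrableOn (fun x => Real.exp (-h x) ^ 2) (Set.Ioi 0) volume := by
  refine integrable_of_isBigO_exp_neg (b := 2 * c) (by positivity)
    (by fun_prop) (Asymptotics.IsBigO.of_bound (Real.exp (2 * K)) ?_)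
  filter_upwards [eventually_ge_atTop R] with x hx
  rw [Real.norm_eq_abs, Real.norm_eq_abs, abs_of_nonneg (by positivity),
    abs_of_nonneg (by positivity), ← Real.exp_add, ← Real.exp_nat_mul]
  refine Real.exp_le_exp.2 ?_
  have := hh x hx
  push_cast
  linarith

theorem memLp_exp_neg_of_linear_le {h : ℝ → ℝ} (hc : Continuous h) {c K R : ℝ} (hc0 : 0 < c)
    (hh : ∀ x ≥ R, c * x - K ≤ h x) (hh' : ∀ x ≥ R, c * x - K ≤ h (-x)) :
    MemLp (fun x => Real.exp (-h x)) 2 volume := by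
  have hcont : Continuous fun x => Real.exp (-h x) := by fun_prop
  rw [memLp_two_iff_integrable_sq hcont.aestronglyMeasurable, ← integrableOn_univ,
    ← Set.Iic_union_Ioi (a := (0 : ℝ))]
  refine IntegrableOn.union ?_ (integrableOn_exp_neg_of_linear_le hc hc0 hh)
  rw [integrableOn_Iic_iff_integrableOn_Iio]
  have := integrableOn_exp_neg_of_linear_le (h := fun x => h (-x)) (by fun_prop) hc0 hh'
  rw [← neg_zero] at this
  simpa only [neg_neg] using this.comp_neg_Iio

/-- If `g ≤ -c` near `-∞` and `c ≤ g` near `+∞`, then `exp (-∫₀ˣ g)` is square integrable. -/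
theorem memLp_exp_neg_integral {g : ℝ → ℝ} (hg : LocallyIntegrable g volume) {c R : ℝ}
    (hc0 : 0 < c) (hp : ∀ᵐ x, R ≤ x → c ≤ g x) (hn : ∀ᵐ x, x ≤ -R → g x ≤ -c) :
    MemLp (fun x => Real.exp (-∫ t in 0..x, g t)) 2 volume := by
  have hi := hg.intervalIntegrable_real
  have hcont := intervalIntegral.continuous_primitive hi 0
  -- Beyond `±R` the primitive gains at least `c (|x| - R)`; `K` absorbs `c * R` and the values at
  -- both points `±R`, so that one constant serves both sides.
  refine memLp_exp_neg_of_linear_le hcont (R := R)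
    (K := c * R + |∫ t in 0..R, g t| + |∫ t in 0..(-R), g t|) hc0 (fun x hx => ?_) fun x hx => ?_
  · have h1 := intervalIntegral.integral_add_adjacent_intervals (hi 0 R) (hi R x)
    have h2 : ∫ _ in R..x, c ≤ ∫ t in R..x, g t :=
      intervalIntegral.integral_mono_ae_restrict hx (by simp) (hi _ _) (by
        rw [EventuallyLE, ae_restrict_iff' measurableSet_Icc]
        filter_upwards [hp] with t ht htx using ht htx.1)
    simp only [intervalIntegral.integral_const, smul_eq_mul] at h2
    have h3 := neg_abs_le (∫ t in 0..R, g t)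
    have h4 := abs_nonneg (∫ t in 0..(-R), g t)
    linarith
  · have h1 := intervalIntegral.integral_add_adjacent_intervals (hi 0 (-R)) (hi (-R) (-x))
    have h2 : ∫ t in (-x)..(-R), g t ≤ ∫ _ in (-x)..(-R), -c :=
      intervalIntegral.integral_mono_ae_restrict (by linarith) (hi _ _) (by simp) (by
        rw [EventuallyLE, ae_restrict_iff' measurableSet_Icc]
        filter_upwards [hn] with t ht htx using ht htx.2)
    simp only [intervalIntegral.integral_const, smul_eq_mul] at h2
    rw [intervalIntegral.integral_symm (-R) (-x)] at h2
    have h3 := neg_abs_le (∫ t in 0..(-R), g t)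
    have h4 := abs_nonneg (∫ t in 0..R, g t)
    linarith

end Decay

/-! ### The massless solution -/

section Gauge

/-- The massless solution `exp (i ∫₀ˣ (v - l))`. -/
noncomputable def masslessMode (v : ℝ → ℂ) (l : ℝ) (x : ℝ) : ℂ :=
  Complex.exp (∫ t in 0..x, Complex.I * (v t - l))

/-- The modulus `exp (-∫₀ˣ Im v)` of the massless solution. -/
noncomputable def masslessWeight (v : ℝ → ℂ) (x : ℝ) : ℝ := Real.exp (-∫ t in 0..x, (v t).im)

variable {v : ℝ → ℂ}

/-- A real `l` contributes only a phase. This independence of `l` is what makes the later estimates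
uniform. -/
theorem norm_masslessMode (hv : MemLinftyLoc v) (l x : ℝ) :
    ‖masslessMode v l x‖ = masslessWeight v x := by
  have hi := (hv.const_mul_sub Complex.I l).locallyIntegrable.intervalIntegrable_real 0 x
  have := Complex.reCLM.intervalIntegral_comp_comm hi
  rw [masslessMode, Complex.norm_exp, masslessWeight, ← intervalIntegral.integral_neg,
    ← Complex.reCLM_apply, ← this]
  simp

theorem continuous_masslessMode (hv : MemLinftyLoc v) (l : ℝ) :
    Continuous (masslessMode v l) :=
  Complex.continuous_exp.comp (intervalIntegral.continuous_primitive
    (hv.const_mul_sub Complex.I l).locallyIntegrable.intervalIntegrable_real 0)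

theorem continuous_masslessWeight (hv : MemLinftyLoc v) : Continuous (masslessWeight v) := by
  simpa only [norm_masslessMode hv] using (continuous_masslessMode hv 0).norm

theorem ae_hasDerivAt_masslessMode (hv : MemLinftyLoc v) (l : ℝ) :
    ∀ᵐ x, HasDerivAt (masslessMode v l) (masslessMode v l x * (Complex.I * (v x - l))) x := by
  filter_upwards [LocallyIntegrable.ae_hasDerivAt_integral
    (hv.const_mul_sub Complex.I l).locallyIntegrable] with x hx using (hx 0).cexp

/-- The weak form of `(χ U)' = χ' U + i (v - l) χ U`, where `U` is the massless solution. -/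
theorem integral_test_mul_masslessMode (hv : MemLinftyLoc v) (l : ℝ) {φ χ : ℝ → ℂ}
    (hφ : IsTestFunction φ) (hχ : ContDiff ℝ 1 χ) :
    ∫ x, (deriv φ x * (χ x * masslessMode v l x) + φ x * (deriv χ x * masslessMode v l x
      + Complex.I * (v x - l) * (χ x * masslessMode v l x))) = 0 := by
  set U := masslessMode v l with hU
  set F' : ℝ → ℂ := fun x => deriv φ x * (χ x * U x) + φ x * (deriv χ x * U x
      + Complex.I * (v x - l) * (χ x * U x)) with hF'
  obtain ⟨R, hR⟩ := hφ.2.isCompact.isBounded.subset_ball (0 : ℝ)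
  have hzero : ∀ x ∉ Set.Ioo (-R) R, φ x = 0 ∧ deriv φ x = 0 := fun x hx => by
    have hx' : x ∉ tsupport φ := fun h => hx (by simpa [Real.ball_eq_Ioo] using hR h)
    exact ⟨image_eq_zero_of_notMem_tsupport hx',
      image_eq_zero_of_notMem_tsupport fun h => hx' (tsupport_deriv_subset h)⟩
  have hUc : Continuous U := continuous_masslessMode hv l
  have hφ1 : ContDiff ℝ 1 φ := hφ.1.of_le (by exact_mod_cast le_top)
  have hφc := hφ1.continuous
  have hφc' : Continuous (deriv φ) := hφ1.continuous_deriv le_rfl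
  have hχc := hχ.continuous
  have hχc' : Continuous (deriv χ) := hχ.continuous_deriv le_rfl
  -- Every factor except `v` is continuous, so local boundedness of `v` suffices.
  have hF'm : MemLinftyLoc F' := fun K hK => by
    have hcK : ∀ {g : ℝ → ℂ}, Continuous g → MemLp g ⊤ (volume.restrict K) := fun {g} hg => by
      obtain ⟨M, hM⟩ := hK.exists_bound_of_continuousOn hg.continuousOn
      exact memLp_top_of_bound hg.aestronglyMeasurable M
        ((ae_restrict_iff' hK.measurableSet).2 (ae_of_all _ hM))
    have h1 : MemLp (fun x => deriv φ x * (χ x * U x) + φ x * (deriv χ x * U x)) ⊤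
        (volume.restrict K) := hcK (by fun_prop)
    have h2 : MemLp (fun x => (φ x * (χ x * U x)) * (Complex.I * (v x - l))) ⊤
        (volume.restrict K) :=
      (hv.const_mul_sub Complex.I l K hK).mul (hcK (by fun_prop))
    refine (h1.add h2).ae_eq (ae_of_all _ fun x => ?_)
    simp only [hF', Pi.add_apply]
    ring
  have hsupp : Function.support F' ⊆ Set.Ioc (-R) R := fun x hx => by
    by_contra hx'
    obtain ⟨h1, h2⟩ := hzero x fun h => hx' ⟨h.1, h.2.le⟩
    exact hx (by simp [hF', h1, h2])
  rw [← intervalIntegral.integral_eq_integral_of_support_subset hsupp]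
  -- The integrand is almost everywhere the derivative of `φ χ U`, which vanishes at `±R`.
  refine intervalIntegral_eq_zero_of_absolutelyContinuous (F := fun x => φ x • (χ x • U x))
    ?_ (hF'm.absolutelyContinuousOnInterval_integral _ _ _) hF'm.locallyIntegrable ?_ ?_ ?_
  · exact hφ1.contDiffOn.absolutelyContinuousOnInterval.fun_smul
      (hχ.contDiffOn.absolutelyContinuousOnInterval.fun_smul
        ((hv.const_mul_sub Complex.I l).absolutelyContinuousOnInterval_cexp _ _))
  · filter_upwards [ae_hasDerivAt_masslessMode hv l] with x hx
    have hφx := (hφ1.differentiable (by decide) x).hasDerivAt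
    have hχx := (hχ.differentiable (by decide) x).hasDerivAt
    convert! hφx.mul (hχx.mul hx) using 1
    simp only [hF', hU, Pi.mul_apply]
    ring
  · simp [(hzero (-R) (by simp)).1]
  · simp [(hzero R (by simp)).1]

end Gauge

end DiracPseudomodes
namespace DiracPseudomodes

/-! ### First order correction for the mass -/

section Quasimode

variable {v : ℝ → ℂ}

/-- The action of the Dirac operator on `(a χ U, b χ U)`, where `U` is the massless solution and
`a`, `b` are the first order corrections of `1/2`, `-1/2` in powers of `1/l`. -/
theorem diracEq_correctedMode (hv : MemLinftyLoc v) (m : ℝ) {l : ℝ} (hl : l ≠ 0)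
    {χ : ℝ → ℂ} (hχ : ContDiff ℝ 1 χ) {D E VD : Lp ℂ 2 (volume : Measure ℝ)}
    (hD : D =ᵐ[volume] fun x => χ x * masslessMode v l x)
    (hE : E =ᵐ[volume] fun x => deriv χ x * masslessMode v l x)
    (hVD : VD =ᵐ[volume] fun x => v x * D x) {a b : ℂ}
    (ha : a = m / (4 * l) + 1 / 2) (hb : b = m / (4 * l) - 1 / 2) :
    DiracEq m (electric v) (WithLp.toLp 2 ![a • D, b • D])
      (WithLp.toLp 2
        ![(-(Complex.I * b)) • E + ((m / (2 * l) : ℂ) • VD + (m ^ 2 / (4 * l) : ℂ) • D),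
          (-(Complex.I * a)) • E + ((m / (2 * l) : ℂ) • VD - (m ^ 2 / (4 * l) : ℂ) • D)]
        + (l : ℂ) • WithLp.toLp 2 ![a • D, b • D]) := by
  have hl' : (l : ℂ) ≠ 0 := by exact_mod_cast hl
  have hsD : ∀ c : ℂ, (c • D : Lp ℂ 2 (volume : Measure ℝ)) =ᵐ[volume] fun x => c * D x :=
    fun c => Lp.coeFn_smul c D
  refine ⟨fun i j => ?_, fun φ hφ => ?_⟩
  · have hVDi := locallyIntegrable_coe VD
    have key : ∀ c : ℂ, LocallyIntegrable (fun x => v x * (c • D : Lp ℂ 2 volume) x) volume := by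
      intro c
      refine (hVDi.smul c).congr ?_
      filter_upwards [hVD, hsD c] with x h1 h2
      simp only [Pi.smul_apply, smul_eq_mul, h1, h2]
      ring
    have hz : LocallyIntegrable (fun _ : ℝ => (0 : ℂ)) volume := locallyIntegrable_const 0
    fin_cases i <;> fin_cases j <;> simp [electric, key, hz]
  have hZ := integral_test_mul_masslessMode hv l hφ hχ
  set Z : ℝ → ℂ := fun x => deriv φ x * (χ x * masslessMode v l x)
    + φ x * (deriv χ x * masslessMode v l x
      + Complex.I * (v x - l) * (χ x * masslessMode v l x)) with hZdef
  have hZi : Integrable Z volume := by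
    have h1 := (hφ.integrable_deriv_mul (locallyIntegrable_coe D)).const_mul (-Complex.I)
    have h2 := hφ.integrable_mul ((locallyIntegrable_coe E).add
      (((locallyIntegrable_coe VD).smul Complex.I).sub
        ((locallyIntegrable_coe D).smul (Complex.I * l))))
    refine (h1.add h2).congr ?_
    filter_upwards [hD, hE, hVD] with x h1 h2 h3
    simp only [Pi.add_apply, Pi.sub_apply, Pi.smul_apply, smul_eq_mul, h3, h1, h2, hZdef]
    linear_combination (-deriv φ x * (χ x * masslessMode v l x)) * Complex.I_sq
  -- Multiples of `Z` integrate to zero, so each component of the weak equation reduces to a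
  -- pointwise identity modulo `Z`. The multiplier is `i` times the coefficient of the
  -- differentiated component.
  have transfer : ∀ (F : ℝ → ℂ) (G : Lp ℂ 2 (volume : Measure ℝ)) (c : ℂ),
      (∀ᵐ x, F x = φ x * G x + c * Z x) → ∫ x, F x = ∫ x, φ x * G x := by
    intro F G c h
    rw [integral_congr_ae h, integral_add (hφ.integrable_mul (locallyIntegrable_coe G))
      (hZi.const_mul c), integral_const_mul, hZ, mul_zero, add_zero]
  constructor
  · refine transfer _ _ (Complex.I * b) ?_
    simp only [PiLp.add_apply, PiLp.smul_apply, Matrix.cons_val_zero,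
      Matrix.cons_val_one, smul_smul]
    filter_upwards [hD, hE, hVD, hsD a, hsD b, hsD (l * a), hsD (m ^ 2 / (4 * l)),
      Lp.coeFn_smul (-(Complex.I * b)) E, Lp.coeFn_smul (m / (2 * l) : ℂ) VD,
      Lp.coeFn_add ((-(Complex.I * b)) • E + ((m / (2 * l) : ℂ) • VD + (m ^ 2 / (4 * l) : ℂ) • D))
        (((l : ℂ) * a) • D),
      Lp.coeFn_add ((-(Complex.I * b)) • E)
        ((m / (2 * l) : ℂ) • VD + (m ^ 2 / (4 * l) : ℂ) • D),
      Lp.coeFn_add ((m / (2 * l) : ℂ) • VD) ((m ^ 2 / (4 * l) : ℂ) • D)]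
      with x e1 e2 e3 e4 e5 e6 e7 e8 e9 e10 e11 e12
    simp only [e10, Pi.add_apply, e11, e12, e9, e8, e7, e6, e5, e4, Pi.smul_apply, smul_eq_mul, e3,
      e2, e1, hZdef, electric, Matrix.of_apply, Matrix.cons_val_zero, Matrix.cons_val_one,
      Matrix.cons_val', Matrix.cons_val_fin_one]
    rw [ha, hb]
    field_simp
    ring_nf
    simp only [Complex.I_sq]
    ring
  · refine transfer _ _ (Complex.I * a) ?_
    simp only [PiLp.add_apply, PiLp.smul_apply, Matrix.cons_val_zero,
      Matrix.cons_val_one, smul_smul]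
    filter_upwards [hD, hE, hVD, hsD a, hsD b, hsD (l * b), hsD (m ^ 2 / (4 * l)),
      Lp.coeFn_smul (-(Complex.I * a)) E, Lp.coeFn_smul (m / (2 * l) : ℂ) VD,
      Lp.coeFn_add ((-(Complex.I * a)) • E + ((m / (2 * l) : ℂ) • VD - (m ^ 2 / (4 * l) : ℂ) • D))
        (((l : ℂ) * b) • D),
      Lp.coeFn_add ((-(Complex.I * a)) • E)
        ((m / (2 * l) : ℂ) • VD - (m ^ 2 / (4 * l) : ℂ) • D),
      Lp.coeFn_sub ((m / (2 * l) : ℂ) • VD) ((m ^ 2 / (4 * l) : ℂ) • D)]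
      with x e1 e2 e3 e4 e5 e6 e7 e8 e9 e10 e11 e12
    simp only [e10, Pi.add_apply, Pi.sub_apply, e11, e12, e9, e8, e7, e6, e5, e4, Pi.smul_apply,
      smul_eq_mul, e3, e2, e1, hZdef, electric, Matrix.of_apply, Matrix.cons_val_zero,
      Matrix.cons_val_one, Matrix.cons_val', Matrix.cons_val_fin_one]
    rw [ha, hb]
    field_simp
    ring_nf
    simp only [Complex.I_sq]
    ring

theorem SpinorSpace.norm_le_add (f : SpinorSpace) : ‖f‖ ≤ ‖f 0‖ + ‖f 1‖ := by
  have h := PiLp.norm_sq_eq_of_L2 _ f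
  rw [Fin.sum_univ_two] at h
  nlinarith [norm_nonneg f, norm_nonneg (f 0), norm_nonneg (f 1)]

/-- The commutator term `E` carries no factor `1/|l|`, unlike the remaining terms: the two must be
made small by different parameters. -/
theorem exists_correctedMode (hv : MemLinftyLoc v) {m : ℝ} (hm : 0 ≤ m) {l : ℝ} (hl : 1 ≤ |l|)
    {χ : ℝ → ℂ} (hχ : ContDiff ℝ 1 χ) {D E VD : Lp ℂ 2 (volume : Measure ℝ)}
    (hD : D =ᵐ[volume] fun x => χ x * masslessMode v l x)
    (hE : E =ᵐ[volume] fun x => deriv χ x * masslessMode v l x)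
    (hVD : VD =ᵐ[volume] fun x => v x * D x) :
    ∃ Ψ : (diracOperator m (electric v)).domain, ‖D‖ ≤ 2 * ‖(Ψ : SpinorSpace)‖ ∧
      ‖diracOperator m (electric v) Ψ - (l : ℂ) • (Ψ : SpinorSpace)‖
        ≤ (m + 1) * (2 * ‖E‖) + (m * ‖VD‖ + m ^ 2 * ‖D‖) / |l| := by
  have hl0 : l ≠ 0 := by rintro rfl; simp at hl; linarith
  have hlp : 0 < |l| := by linarith
  set a : ℂ := m / (4 * l) + 1 / 2 with ha
  set b : ℂ := m / (4 * l) - 1 / 2 with hb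
  have h := diracEq_correctedMode hv m hl0 hχ hD hE hVD ha hb
  set f : SpinorSpace := WithLp.toLp 2 ![a • D, b • D] with hf
  refine ⟨⟨f, _, h⟩, ?_, ?_⟩
  -- Since `a - b = 1`, the difference of the components recovers `D`, which bounds the norm of the
  -- mode from below.
  · have e : D = f 0 - f 1 := by
      simp only [hf, PiLp.toLp_apply, Matrix.cons_val_zero, Matrix.cons_val_one, ← sub_smul]
      rw [show a - b = 1 by rw [ha, hb]; ring, one_smul]
    calc ‖D‖ = ‖f 0 - f 1‖ := by rw [← e]
      _ ≤ ‖f 0‖ + ‖f 1‖ := norm_sub_le _ _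
      _ ≤ ‖f‖ + ‖f‖ := add_le_add (PiLp.norm_apply_le f 0) (PiLp.norm_apply_le f 1)
      _ = 2 * ‖f‖ := by ring
  · rw [(diracOperator_apply_eq_iff ⟨f, _, h⟩ _).2 h, add_sub_cancel_right]
    refine (SpinorSpace.norm_le_add _).trans ?_
    simp only [Matrix.cons_val_zero, Matrix.cons_val_one]
    have hh : ‖(1 / 2 : ℂ)‖ = 1 / 2 := by norm_num
    have hq : ‖(m / (4 * l) : ℂ)‖ ≤ m / 4 := by
      simp only [norm_div, norm_mul, Complex.norm_real, Complex.norm_ofNat, Real.norm_eq_abs,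
        abs_of_nonneg hm]
      exact div_le_div_of_nonneg_left hm (by norm_num) (by linarith)
    have han : ‖a‖ ≤ m + 1 := (norm_add_le _ _).trans (by rw [hh]; linarith)
    have hbn : ‖b‖ ≤ m + 1 := (norm_sub_le _ _).trans (by rw [hh]; linarith)
    have n1 : ‖(m / (2 * l) : ℂ)‖ = m / (2 * |l|) := by
      simp [abs_of_nonneg hm]
    have n2 : ‖(m ^ 2 / (4 * l) : ℂ)‖ = m ^ 2 / (4 * |l|) := by
      simp
    have t1 := norm_add₃_le (a := (-(Complex.I * b)) • E) (b := (m / (2 * l) : ℂ) • VD)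
      (c := (m ^ 2 / (4 * l) : ℂ) • D)
    have t2 := norm_add_le ((-(Complex.I * a)) • E)
      ((m / (2 * l) : ℂ) • VD - (m ^ 2 / (4 * l) : ℂ) • D)
    have t3 := norm_sub_le ((m / (2 * l) : ℂ) • VD) ((m ^ 2 / (4 * l) : ℂ) • D)
    rw [add_assoc] at t1
    simp only [norm_smul, n1, n2, norm_neg, norm_mul, Complex.norm_I, one_mul] at t1 t2 t3
    have t4 := mul_le_mul_of_nonneg_right han (norm_nonneg E)
    have t5 := mul_le_mul_of_nonneg_right hbn (norm_nonneg E)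
    have t6 : m / (2 * |l|) * ‖VD‖ + m / (2 * |l|) * ‖VD‖ = m * ‖VD‖ / |l| := by
      field_simp; ring
    have t7 : m ^ 2 / (4 * |l|) * ‖D‖ + m ^ 2 / (4 * |l|) * ‖D‖ ≤ m ^ 2 * ‖D‖ / |l| := by
      rw [← sub_nonneg, show m ^ 2 * ‖D‖ / |l| - (m ^ 2 / (4 * |l|) * ‖D‖
        + m ^ 2 / (4 * |l|) * ‖D‖) = m ^ 2 * ‖D‖ / (2 * |l|) by field_simp; ring]
      positivity
    rw [add_div]
    linarith

end Quasimode

/-! ### Slowly varying cutoffs -/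

section Cutoff

/-- A smooth function equal to `1` on `[-X, X]` and to `0` outside `[-2X, 2X]`. -/
theorem exists_slow_cutoff : ∃ C : ℝ, 0 ≤ C ∧ ∀ X : ℝ, 1 ≤ X → ∃ χ : ℝ → ℂ, ContDiff ℝ 1 χ ∧
    (∀ x, ‖χ x‖ ≤ 1) ∧ (∀ x ∈ Set.Icc (-1 : ℝ) 1, χ x = 1) ∧
    (∀ x ∉ Set.Icc (-(2 * X)) (2 * X), χ x = 0) ∧ ∀ x, ‖deriv χ x‖ ≤ C / X := by
  -- One fixed bump is dilated by `X`: its derivative gains a factor `1/X`, so `C` bounds `β'` and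
  -- does not depend on `X`.
  let β : ContDiffBump (0 : ℝ) := ⟨1, 2, one_pos, one_lt_two⟩
  have hβ : ContDiff ℝ 1 (fun x => (β x : ℂ)) := Complex.ofRealCLM.contDiff.comp β.contDiff
  have hβs : HasCompactSupport (fun x => (β x : ℂ)) :=
    β.hasCompactSupport.comp_left (g := fun r : ℝ => (r : ℂ)) (by simp)
  obtain ⟨C, hC⟩ := (hβ.continuous_deriv le_rfl).bounded_above_of_compact_support hβs.deriv
  refine ⟨C, (norm_nonneg _).trans (hC 0), fun X hX => ?_⟩
  have hX0 : 0 < X := by linarith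
  refine ⟨fun x => (β (X⁻¹ * x) : ℂ), hβ.comp (contDiff_const.mul contDiff_id), fun x => ?_,
    fun x hx => ?_, fun x hx => ?_, fun x => ?_⟩
  · simpa [abs_of_nonneg (β.nonneg)] using β.le_one
  · have : X⁻¹ * x ∈ Metric.closedBall (0 : ℝ) β.rIn := by
      have h1 : X⁻¹ ≤ 1 := inv_le_one_of_one_le₀ hX
      have h2 : |x| ≤ 1 := abs_le.2 hx
      rw [mem_closedBall_zero_iff, norm_mul, Real.norm_eq_abs, Real.norm_eq_abs, abs_inv,
        abs_of_pos hX0]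
      exact mul_le_one₀ h1 (abs_nonneg _) h2
    simp [β.one_of_mem_closedBall this]
  · have : β.rOut ≤ dist (X⁻¹ * x) 0 := by
      have h2 : 2 * X < |x| := by
        by_contra! h
        exact hx (abs_le.1 h)
      rw [dist_zero_right, norm_mul, Real.norm_eq_abs, Real.norm_eq_abs, abs_inv, abs_of_pos hX0,
        inv_mul_eq_div, le_div_iff₀ hX0]
      exact h2.le
    simp [β.zero_of_le_dist this]
  · have hd := (((hβ.differentiable (by decide) (X⁻¹ * x)).hasDerivAt).scomp x
      ((hasDerivAt_id x).const_mul X⁻¹)).deriv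
    have : deriv (fun x => (β (X⁻¹ * x) : ℂ)) x = _ := hd
    rw [this, norm_smul, mul_one, norm_inv, Real.norm_eq_abs, abs_of_pos hX0, inv_mul_eq_div]
    exact div_le_div_of_nonneg_right (hC _) hX0.le

end Cutoff

/-! ### Approximate eigenvectors for large `|l|` -/

section Approximation

variable {v : ℝ → ℂ}

/-- For every `ε > 0`, all real `l` of large modulus are `ε`-approximate eigenvalues. -/
theorem exists_approximate_eigenvector (hv : MemLinftyLoc v)
    (hW : MemLp (masslessWeight v) 2 volume) {m : ℝ} (hm : 0 ≤ m) {ε : ℝ} (hε : 0 < ε) :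
    ∃ Λ : ℝ, ∀ l : ℝ, Λ ≤ |l| → ∃ Ψ : (diracOperator m (electric v)).domain, Ψ ≠ 0 ∧
      ‖diracOperator m (electric v) Ψ - (l : ℂ) • (Ψ : SpinorSpace)‖
        ≤ ε * ‖(Ψ : SpinorSpace)‖ := by
  obtain ⟨C, hC0, hcut⟩ := exists_slow_cutoff
  set W : Lp ℝ 2 (volume : Measure ℝ) := hW.toLp _
  have hWx : W =ᵐ[volume] masslessWeight v := hW.coeFn_toLp
  -- Every cutoff equals `1` on `[-1, 1]`, so the weight there gives a lower bound for `‖D‖`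
  -- independent of `X` and `l`.
  have hW1 := hW.indicator (measurableSet_Icc (a := (-1 : ℝ)) (b := 1))
  set W₁ : Lp ℝ 2 (volume : Measure ℝ) := hW1.toLp _
  have hW1x : W₁ =ᵐ[volume] (Set.Icc (-1 : ℝ) 1).indicator (masslessWeight v) := hW1.coeFn_toLp
  have hpos : ∀ x, 0 < masslessWeight v x := fun x => Real.exp_pos _
  have hκ : 0 < ‖W₁‖ := by
    rw [norm_pos_iff]
    intro h0
    have h1 : (Set.Icc (-1 : ℝ) 1).indicator (masslessWeight v) =ᵐ[volume] 0 :=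
      hW1x.symm.trans (h0 ▸ Lp.coeFn_zero ℝ 2 volume)
    have h2 : ∀ᵐ x : ℝ, x ∉ Set.Icc (-1 : ℝ) 1 := by
      filter_upwards [h1] with x hx hmem
      rw [Set.indicator_of_mem hmem] at hx
      exact (hpos x).ne' hx
    have h3 := measure_eq_zero_iff_ae_notMem.2 h2
    norm_num at h3
  set κ := ‖W₁‖
  -- the cutoff scale makes the commutator term small, uniformly in `l`
  obtain ⟨X, hX1, hX⟩ : ∃ X : ℝ, 1 ≤ X ∧ (m + 1) * (2 * (C / X * ‖W‖)) ≤ ε * κ / 4 := by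
    have : Tendsto (fun X : ℝ => (m + 1) * (2 * (C / X * ‖W‖))) atTop (𝓝 0) := by
      have h := (((tendsto_const_nhds (x := C)).div_atTop tendsto_id).mul_const ‖W‖).const_mul
        2 |>.const_mul (m + 1)
      simpa using h
    obtain ⟨X, h1, h2⟩ := ((this.eventually_le_const (by positivity : 0 < ε * κ / 4)).and
      (eventually_ge_atTop 1)).exists
    exact ⟨X, h2, h1⟩
  obtain ⟨χ, hχ, hχ1, hχe, hχ0, hχd⟩ := hcut X hX1
  have hsupp : HasCompactSupport χ := HasCompactSupport.intro isCompact_Icc hχ0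
  -- With `X` fixed, `v` is bounded on the support of `χ`, so `M` and `B` do not depend on `l`.
  obtain ⟨M, hM0, hM⟩ := hv.exists_ae_norm_le
    (isCompact_Icc (a := -(2 * X)) (b := 2 * X))
  set B := m * (M * ‖W‖) + m ^ 2 * ‖W‖ with hB
  -- The second entry forces `B / |l| ≤ ε κ / 4`. Together with the commutator this gives at most `ε
  -- κ / 2`, and `κ ≤ 2 ‖Ψ‖`.
  refine ⟨max 1 (B / (ε * κ / 4)), fun l hl => ?_⟩
  have hl1 : 1 ≤ |l| := (le_max_left _ _).trans hl
  have hlB : B / |l| ≤ ε * κ / 4 :=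
    div_le_of_le_mul₀ (abs_nonneg _) (by positivity)
      ((div_le_iff₀' (by positivity)).1 ((le_max_right _ _).trans hl))
  have hUc := continuous_masslessMode hv l
  have hUn := norm_masslessMode hv l
  have hDm : MemLp (fun x => χ x * masslessMode v l x) 2 volume :=
    (hχ.continuous.mul hUc).memLp_of_hasCompactSupport hsupp.mul_right
  have hEm : MemLp (fun x => deriv χ x * masslessMode v l x) 2 volume :=
    ((hχ.continuous_deriv le_rfl).mul hUc).memLp_of_hasCompactSupport hsupp.deriv.mul_right
  set D := hDm.toLp
  set E := hEm.toLp
  have hD : D =ᵐ[volume] fun x => χ x * masslessMode v l x := hDm.coeFn_toLp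
  have hE : E =ᵐ[volume] fun x => deriv χ x * masslessMode v l x := hEm.coeFn_toLp
  have hvD : ∀ᵐ x, ‖v x * D x‖ ≤ M * ‖D x‖ := by
    filter_upwards [hM, hD] with x h1 h2
    by_cases hx : x ∈ Set.Icc (-(2 * X)) (2 * X)
    · rw [norm_mul]
      exact mul_le_mul_of_nonneg_right (h1 hx) (norm_nonneg _)
    · simp [h2, hχ0 x hx]
  have hVDm : MemLp (fun x => v x * D x) 2 volume :=
    (Lp.memLp D).of_le_mul
      (hv.locallyIntegrable.aestronglyMeasurable.mul (Lp.aestronglyMeasurable D)) hvD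
  set VD := hVDm.toLp
  have hVD : VD =ᵐ[volume] fun x => v x * D x := hVDm.coeFn_toLp
  obtain ⟨Ψ, h1, h2⟩ := exists_correctedMode hv hm hl1 hχ hD hE hVD
  have nD : ‖D‖ ≤ ‖W‖ := by
    refine Lp.norm_le_norm_of_ae_le ?_
    filter_upwards [hD, hWx] with x e1 e2
    rw [e1, e2, norm_mul, hUn, Real.norm_of_nonneg (hpos x).le]
    exact mul_le_of_le_one_left (hpos x).le (hχ1 x)
  have nκ : κ ≤ ‖D‖ := by
    refine Lp.norm_le_norm_of_ae_le ?_
    filter_upwards [hD, hW1x] with x e1 e2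
    rw [e1, e2]
    by_cases hx : x ∈ Set.Icc (-1 : ℝ) 1
    · rw [Set.indicator_of_mem hx, norm_mul, hUn, hχe x hx, Real.norm_of_nonneg (hpos x).le]
      simp
    · rw [Set.indicator_of_notMem hx, norm_zero]
      exact norm_nonneg _
  have nE : ‖E‖ ≤ C / X * ‖W‖ := by
    refine Lp.norm_le_mul_norm_of_ae_le_mul ?_
    filter_upwards [hE, hWx] with x e1 e2
    rw [e1, e2, norm_mul, hUn, Real.norm_of_nonneg (hpos x).le]
    exact mul_le_mul_of_nonneg_right (hχd x) (hpos x).le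
  have nVD : ‖VD‖ ≤ M * ‖W‖ := by
    refine le_trans (Lp.norm_le_mul_norm_of_ae_le_mul ?_) (mul_le_mul_of_nonneg_left nD hM0)
    filter_upwards [hVD, hvD] with x e1 e2
    rwa [e1]
  have nΨ : κ ≤ 2 * ‖(Ψ : SpinorSpace)‖ := nκ.trans h1
  refine ⟨Ψ, ?_, h2.trans ?_⟩
  · rintro rfl
    simp at nΨ
    linarith
  · calc (m + 1) * (2 * ‖E‖) + (m * ‖VD‖ + m ^ 2 * ‖D‖) / |l|
        ≤ (m + 1) * (2 * (C / X * ‖W‖)) + B / |l| := by rw [hB]; gcongr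
      _ ≤ ε * κ / 4 + ε * κ / 4 := add_le_add hX hlB
      _ ≤ ε * ‖(Ψ : SpinorSpace)‖ := by nlinarith

end Approximation

/-! ### Choosing one family -/

section Selection

/-- If for each `ε > 0` all `l` of large modulus admit a point where `q l` is at most `ε`, there is
a single selection of points along which `q l` tends to `0`. -/
theorem exists_selection_tendsto_zero {S : Type*} {p : S → Prop} (q : ℝ → S → ℝ)
    (hq : ∀ l s, 0 ≤ q l s)
    (h : ∀ ε > 0, ∃ Λ : ℝ, ∀ l : ℝ, Λ ≤ |l| → ∃ s, p s ∧ q l s ≤ ε) :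
    ∃ Ψ : ℝ → S, (∀ l, p (Ψ l)) ∧
      Tendsto (fun l => q l (Ψ l)) (comap (fun l : ℝ => |l|) atTop) (𝓝 0) := by
  obtain ⟨s₀, hs₀⟩ : ∃ s, p s := by
    obtain ⟨Λ, hΛ⟩ := h 1 one_pos
    obtain ⟨s, hs, -⟩ := hΛ Λ (le_abs_self Λ)
    exact ⟨s, hs⟩
  have hne : ∀ l, (q l '' {s | p s}).Nonempty := fun l => ⟨_, s₀, hs₀, rfl⟩
  have hbdd : ∀ l, BddBelow (q l '' {s | p s}) := fun l => ⟨0, by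
    rintro _ ⟨s, -, rfl⟩; exact hq l s⟩
  -- The infimum need not be attained; a slack tending to zero as `|l| → ∞` lets one choice,
  -- independent of `ε`, work for all `ε`.
  have key : ∀ l : ℝ, ∃ s, p s ∧ q l s < sInf (q l '' {s | p s}) + (1 + |l|)⁻¹ := fun l => by
    obtain ⟨_, ⟨s, hs, rfl⟩, hlt⟩ := Real.lt_sInf_add_pos (hne l)
      (by positivity : 0 < (1 + |l|)⁻¹)
    exact ⟨s, hs, hlt⟩
  choose Ψ hΨ hlt using key
  refine ⟨Ψ, hΨ, ?_⟩
  have hinv : Tendsto (fun l : ℝ => (1 + |l|)⁻¹) (comap (fun l : ℝ => |l|) atTop) (𝓝 0) :=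
    (tendsto_atTop_add_const_left _ 1 tendsto_comap).inv_tendsto_atTop
  rw [Metric.tendsto_nhds]
  intro ε hε
  obtain ⟨Λ, hΛ⟩ := h (ε / 2) (by positivity)
  filter_upwards [tendsto_comap.eventually (eventually_ge_atTop Λ),
    hinv.eventually_lt_const (by positivity : 0 < ε / 2)] with l h1 h2
  obtain ⟨s, hs, hsε⟩ := hΛ l h1
  have h3 := csInf_le (hbdd l) ⟨s, hs, rfl⟩
  rw [Real.dist_eq, sub_zero, abs_of_nonneg (hq _ _)]
  linarith [hlt l]

end Selection

end DiracPseudomodes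

/-! ### The main theorem -/

theorem theorem1p1 (m : ℝ) (hm : 0 ≤ m) (v : ℝ → ℂ)
    (hv : DiracPseudomodes.MemWinftyLoc 2 v)
    (hneg : limsup (fun x : ℝ => ((v x).im : EReal)) (atBot ⊓ ae volume) < 0)
    (hpos : 0 < liminf (fun x : ℝ => ((v x).im : EReal)) (atTop ⊓ ae volume))
    (f : ℝ → ℝ) (hf : Continuous f)
    (hf_unbounded : ∀ R M : ℝ, ∃ x : ℝ, R ≤ |x| ∧ M < |f x|)
    (hf_le : ∃ x₀ > (0 : ℝ), ∃ C > (0 : ℝ), ∀ x : ℝ, x₀ ≤ |x| →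
      |f x| ≤ C * ∫ t in (0 : ℝ)..x, (v t).im)
    (νm νp : ℝ)
    (hm_deriv : ∀ n : ℕ, n = 1 ∨ n = 2 → ∃ C : NNReal, ∀ᶠ x in atBot ⊓ ae volume,
      ‖DiracPseudomodes.weakDeriv n v x‖ₑ ≤ (C : ENNReal) * (‖f x‖ₑ ^ (n * νm) * ‖v x‖ₑ))
    (hp_deriv : ∀ n : ℕ, n = 1 ∨ n = 2 → ∃ C : NNReal, ∀ᶠ x in atTop ⊓ ae volume,
      ‖DiracPseudomodes.weakDeriv n v x‖ₑ ≤ (C : ENNReal) * (‖f x‖ₑ ^ (n * νp) * ‖v x‖ₑ)) :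
    ∃ Ψ : ℝ → (DiracPseudomodes.diracOperator m (DiracPseudomodes.electric v)).domain,
      (∀ l : ℝ, Ψ l ≠ 0) ∧
      Tendsto (fun l : ℝ =>
        ‖DiracPseudomodes.diracOperator m (DiracPseudomodes.electric v) (Ψ l)
          - (l : ℂ) • (Ψ l : DiracPseudomodes.SpinorSpace)‖
          / ‖(Ψ l : DiracPseudomodes.SpinorSpace)‖) atTop (𝓝 0) ∧
      Tendsto (fun l : ℝ =>
        ‖DiracPseudomodes.diracOperator m (DiracPseudomodes.electric v) (Ψ l)
          - (l : ℂ) • (Ψ l : DiracPseudomodes.SpinorSpace)‖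
          / ‖(Ψ l : DiracPseudomodes.SpinorSpace)‖) atBot (𝓝 0) := by
  have hvb : DiracPseudomodes.MemLinftyLoc v := hv.memLinftyLoc
  obtain ⟨c₁, hc₁, hn⟩ : ∃ c : ℝ, 0 < c ∧ ∃ R : ℝ, ∀ᵐ x, x ≤ -R → (v x).im ≤ -c := by
    obtain ⟨q, hq, hq0⟩ := EReal.lt_iff_exists_real_btwn.1 hneg
    -- A property eventual along `atBot ⊓ ae` splits into a half-line `s` and a conull set `t`.
    obtain ⟨s, hs, t, ht, hst⟩ := eventually_inf.1 (eventually_lt_of_limsup_lt hq)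
    obtain ⟨R, hR⟩ := mem_atBot_sets.1 hs
    refine ⟨-q, by simpa using hq0, -R, ?_⟩
    filter_upwards [ht] with x hx hxR
    simpa using (EReal.coe_lt_coe_iff.1 (hst x ⟨hR x (by simpa using hxR), hx⟩)).le
  obtain ⟨c₂, hc₂, hp⟩ : ∃ c : ℝ, 0 < c ∧ ∃ R : ℝ, ∀ᵐ x, R ≤ x → c ≤ (v x).im := by
    obtain ⟨q, hq0, hq⟩ := EReal.lt_iff_exists_real_btwn.1 hpos
    obtain ⟨s, hs, t, ht, hst⟩ := eventually_inf.1 (eventually_lt_of_lt_liminf hq)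
    obtain ⟨R, hR⟩ := mem_atTop_sets.1 hs
    refine ⟨q, by simpa using hq0, R, ?_⟩
    filter_upwards [ht] with x hx hxR
    exact (EReal.coe_lt_coe_iff.1 (hst x ⟨hR x hxR, hx⟩)).le
  obtain ⟨R₁, hn⟩ := hn
  obtain ⟨R₂, hp⟩ := hp
  have him : LocallyIntegrable (fun x => (v x).im) volume := fun x => by
    obtain ⟨s, hs, h⟩ := hvb.locallyIntegrable x
    exact ⟨s, hs, Complex.imCLM.integrable_comp h⟩
  have hW : MemLp (DiracPseudomodes.masslessWeight v) 2 volume := by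
    refine DiracPseudomodes.memLp_exp_neg_integral him (c := min c₁ c₂) (R := max R₁ R₂)
      (lt_min hc₁ hc₂) ?_ ?_
    · filter_upwards [hp] with x hx hxR
      exact (min_le_right _ _).trans (hx ((le_max_right _ _).trans hxR))
    · filter_upwards [hn] with x hx hxR
      exact (hx (hxR.trans (neg_le_neg (le_max_left _ _)))).trans (neg_le_neg (min_le_left _ _))
  obtain ⟨Ψ, hΨ, hlim⟩ := DiracPseudomodes.exists_selection_tendsto_zero
    (p := fun Ψ : (DiracPseudomodes.diracOperator m (DiracPseudomodes.electric v)).domain => Ψ ≠ 0)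
    (fun l Ψ => ‖DiracPseudomodes.diracOperator m (DiracPseudomodes.electric v) Ψ
      - (l : ℂ) • (Ψ : DiracPseudomodes.SpinorSpace)‖ / ‖(Ψ : DiracPseudomodes.SpinorSpace)‖)
    (fun l Ψ => by positivity) (fun ε hε => by
      obtain ⟨Λ, hΛ⟩ := DiracPseudomodes.exists_approximate_eigenvector hvb hW hm hε
      refine ⟨Λ, fun l hl => ?_⟩
      obtain ⟨Ψ, h0, h⟩ := hΛ l hl
      exact ⟨Ψ, h0, div_le_of_le_mul₀ (norm_nonneg _) hε.le h⟩)
  -- Convergence as `|l| → ∞` contains both one-sided limits.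
  exact ⟨Ψ, hΨ, hlim.comp (g := _) (tendsto_comap_iff.2 tendsto_abs_atTop_atTop),
    hlim.comp (tendsto_comap_iff.2 tendsto_abs_atBot_atTop)⟩
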